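/- **Setting.** Let $\Sigma$ (function symbols) and $\mathcal X$ (variables) be finite ranked alphabets, possibly overlapping, with a common rank function $\mathrm{rk}:\Sigma\cup\mathcal X\to\mathbb N$, and let $H=\{1,\dots,|H|\}$ be a set of holes, disjoint from $\Sigma\cup\mathcal X$, where $\mathrm{rk}(x)\le |H|$ for all $x\in\Sigma\cup\mathcal X$. Holes and a further symbol $\bot$ have rank $0$. For a ranked alphabet $\Delta$, $T(\Delta)$ is the set of finite and infinite ordered trees $t:\mathrm{Pos}(t)\to\Delta$ in which a position $u$ labeled by $f$ has exactly the children $u.1,\dots,u.\mathrm{rk}(f)$; $\varepsilon$ is the root. For $t\in T(\Sigma\cup H\cup\{\bot\})$ and trees $t_i$ ($i\in H$), $t[i_j\leftarrow t_i]$ is the tree obtained from $t$ by replacing, for every $i\in H$, every leaf of $t$ labeled $i$ by $t_i$. Identifying all trees of $T(\Sigma\cup\mathcal X\cup H\cup\{\bot\})$ that contain $\bot$ with the single tree $\bot$, one obtains the metric space $T(\Sigma\cup \mathcal X\cup H)\cup\{\bot\}$ with $d(s,t)=2^{-\inf\{|u|\,:\,u\in \mathrm{Pos}(s)\cap\mathrm{Pos}(t),\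 s(u)\ne t(u)\}}$ (and $2^{-\infty}=0$). **Choice functions.** A choice function for $s\in T(\Sigma\cup\mathcal X)$ is a map $\gamma$ on $\mathrm{Pos}(s)$ such that for every position $u$ with label $x=s(u)$: $\gamma(u)=\bot$, or $\gamma(u)\in T(\Sigma\cup\{1,\dots,\mathrm{rk}(x)\})$ is not a single hole; and $\gamma(u)=x(1,\dots,\mathrm{rk}(x))$ if $x\in\Sigma\setminus\mathcal X$. Put $\gamma_0(s)=\gamma(\varepsilon)$ and $\gamma_{n}(s)=\gamma(\varepsilon)[i_j\leftarrow(\gamma|_i)_{n-1}(s|_i)]$ for $n>0$, where $s|_i$ is the subtree of $s$ at position $i$ and $\gamma|_i(u)=\gamma(i.u)$. This sequence converges in the above metric space, and $\gamma_\infty(s)$ denotes its limit. **Automata.** A parity-NTA over $\Delta$ is $A=(Q,\Delta,\delta,\chi)$ with $Q$ a nonempty finite set of states, $\delta\subseteq\bigcup_{f\in\Delta}Q\times\{f\}\times Q^{\mathrm{rk}(f)}$ and $\chi:Q\to\{1,\dots,|C|\}$, $|C|$ odd. A run of $t$ is a map $\rho:\mathrm{Pos}(t)\to Q$ with $(\rho(u),t(u),\rho(u.1),\dots,\rho(u.\mathrm{rk}(t(u))))\in\delta$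 for all $u\in\mathrm{Pos}(t)$; it is accepting if on every infinite directed path the least color $\chi\rho(u)$ that occurs infinitely often is even. $\mathrm{Run}_A(t,p)$ is the set of accepting runs of $t$ with $\rho(\varepsilon)=p$, and $L(A,p)=\{t\in T(\Delta):\mathrm{Run}_A(t,p)\neq\emptyset\}$. **Tasks.** Let $B=(Q,\Sigma,\delta,\chi)$ be a parity-NTA over $\Sigma$ (so $L(B,p)\subseteq T(\Sigma)$ for all $p\in Q$), and let $B_H=(Q,\Sigma\cup H,\delta\cup(Q\times H),\chi)$. A task is a tuple $\tau=(p,\psi_1,\dots,\psi_{|H|})$ with $p\in Q$ and $\psi_i:Q\to\{0\}\cup\chi(Q)$. Let $\preceq$ be the linear order $0\preceq2\preceq\cdots\preceq|C|-1\preceq|C|\preceq|C|-2\preceq\cdots\preceq3\preceq1$. Write $t\models\tau$ if there is some $\rho\in\mathrm{Run}_{B_H}(t,p)$ such that for every $i\in H$ and every leaf $v$ of $t$ labeled $i$, the minimum (with respect to $\le$) of $\chi\rho$ on the path from the root to $v$ (both included) is $\preceq\psi_i(\rho(v))$. Write $t\equiv_B t'$ if $t$ and $t'$ satisfy the same tasks.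 **Proposition.** Let $B$ be a parity-NTA over $\Sigma$ with state set $Q$, let $s\in T(\Sigma\cup\mathcal X)$, and let $\gamma,\gamma'$ be two choice functions for $s$ such that $\gamma'(u)\equiv_B\gamma(u)$ for all $u\in\mathrm{Pos}(s)$. Then for every state $p_0\in Q$, $$\gamma_\infty(s)\in L(B,p_0)\iff\gamma'_\infty(s)\in L(B,p_0).$$ -/

import Mathlib

open Filter Topology

universe u v

namespace IOSubst

/-! ### Ranked trees -/

/-- A (finite or infinite) ordered tree over a ranked set of labels.  Positions are finite words
over `ℕ`; the children of `u` are the words `u ++ [i]`, numbered from `0`.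
`lab u = none` means that `u` is not a position. -/
@[ext]
structure RTree {L : Type u} (rk : L → ℕ) where
  /-- the label at a position -/
  lab : List ℕ → Option L
  root_isSome : (lab []).isSome
  child_iff : ∀ (w : List ℕ) (i : ℕ), (lab (w ++ [i])).isSome ↔ ∃ a, lab w = some a ∧ i < rk a

namespace RTree

variable {L : Type u} {rk : L → ℕ}

/-- The set of positions of a tree. -/
def Pos (t : RTree rk) : Set (List ℕ) := {w | (t.lab w).isSome}

/-- `T(Δ)`: the trees all of whose labels lie in `Δ`. -/
def labeledIn (rk : L → ℕ) (Δ : Set L) : Set (RTree rk) := {t | ∀ w a, t.lab w = some a → a ∈ Δ}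

/-- The subtree `t|_w` at a position `w`. -/
def subtree (t : RTree rk) (w : List ℕ) (hw : w ∈ t.Pos) : RTree rk where
  lab := fun z => t.lab (w ++ z)
  root_isSome := by simpa [Pos] using hw
  child_iff := fun z i => by rw [← List.append_assoc]; exact t.child_iff (w ++ z) i

theorem isSome_of_append (t : RTree rk) (w z : List ℕ) (h : (t.lab (w ++ z)).isSome) :
    (t.lab w).isSome := by
  induction z using List.reverseRecOn with
  | nil => simpa using h
  | append_singleton z i ih =>
    apply ih
    rw [← List.append_assoc, t.child_iff] at h
    obtain ⟨a, ha, _⟩ := h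
    simp [ha]

theorem eq_nil_of_rank_zero (t : RTree rk) (w z : List ℕ) (a : L) (ha : t.lab w = some a)
    (hr : rk a = 0) (h : (t.lab (w ++ z)).isSome) : z = [] := by
  cases z with
  | nil => rfl
  | cons i z =>
    have h1 : (t.lab (w ++ [i])).isSome := t.isSome_of_append (w ++ [i]) z (by simpa using h)
    rw [t.child_iff] at h1
    obtain ⟨b, hb, hi⟩ := h1
    rw [ha] at hb
    cases hb
    omega

/-- The levels `|w|` of the common positions `w` of `s` and `t` with `s(w) ≠ t(w)`. -/
def diffLevels (s t : RTree rk) : Set ℕ :=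
  {n | ∃ w, w ∈ s.Pos ∧ w ∈ t.Pos ∧ s.lab w ≠ t.lab w ∧ w.length = n}

theorem agree_iff (s t : RTree rk) (n : ℕ) :
    (∀ w : List ℕ, w.length < n → s.lab w = t.lab w) ↔ ∀ m ∈ diffLevels s t, n ≤ m := by
  constructor
  · rintro h m ⟨w, _, _, hne, rfl⟩
    by_contra hlt
    exact hne (h w (by omega))
  · intro h w
    have key : ∀ w : List ℕ, w.length < n → ((t.lab w).isSome ↔ (s.lab w).isSome) →
        s.lab w = t.lab w := by
      intro w hw hiff
      by_contra hne
      by_cases hs : (s.lab w).isSome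
      · have := h w.length ⟨w, hs, hiff.2 hs, hne, rfl⟩
        omega
      · have ht : ¬ (t.lab w).isSome := fun ht => hs (hiff.1 ht)
        simp only [Bool.not_eq_true, Option.isSome_eq_false_iff, Option.isNone_iff_eq_none]
          at hs ht
        exact hne (hs.trans ht.symm)
    induction w using List.reverseRecOn with
    | nil => exact fun hw => key [] hw (by simp [s.root_isSome, t.root_isSome])
    | append_singleton w i ih =>
      intro hw
      refine key _ hw ?_
      rw [s.child_iff, t.child_iff, ih (by simp at hw; omega)]

theorem diffLevels_nonempty {s t : RTree rk} (h : s ≠ t) : (diffLevels s t).Nonempty := by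
  by_contra hemp
  apply h
  ext1
  funext w
  exact (agree_iff s t (w.length + 1)).2 (fun m hm => (hemp ⟨m, hm⟩).elim) w (by omega)

theorem diffLevels_comm (s t : RTree rk) : diffLevels s t = diffLevels t s := by
  ext n
  constructor <;> rintro ⟨w, h1, h2, h3, h4⟩ <;> exact ⟨w, h2, h1, h3.symm, h4⟩

theorem le_sInf_diffLevels {s t : RTree rk} (h : s ≠ t) (n : ℕ) :
    (∀ w : List ℕ, w.length < n → s.lab w = t.lab w) ↔ n ≤ sInf (diffLevels s t) := by
  rw [agree_iff]
  constructor
  · exact fun H => H _ (Nat.sInf_mem (diffLevels_nonempty h))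
  · exact fun H m hm => H.trans (Nat.sInf_le hm)

end RTree

/-! ### Parity tree automata -/

/-- A nondeterministic parity tree automaton with state set `Q` over the ranked alphabet `Δ`
(a set of labels with ranks `rk`).  `trans p f ps` means `(p, f, ps₀, …, psᵣ₋₁) ∈ δ`. -/
structure ParityNTA {L : Type u} (rk : L → ℕ) (Δ : Set L) (Q : Type v) where
  trans : (p : Q) → (f : L) → (Fin (rk f) → Q) → Prop
  trans_mem : ∀ p f ps, trans p f ps → f ∈ Δ
  /-- the colors are `1, …, numColors` -/
  numColors : ℕ
  odd_numColors : Odd numColors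
  color : Q → ℕ
  color_mem : ∀ q, 1 ≤ color q ∧ color q ≤ numColors

/-- An infinite directed path in the tree `t`. -/
def IsInfinitePath {L : Type u} {rk : L → ℕ} (t : RTree rk) (α : ℕ → List ℕ) : Prop :=
  ∀ k, α k ∈ t.Pos ∧ ∃ i : ℕ, α (k + 1) = α k ++ [i]

namespace ParityNTA

variable {L : Type u} {rk : L → ℕ} {Δ : Set L} {Q : Type v}

/-- `ρ` is a run of `t`.  (Only the values of `ρ` on positions of `t` matter.) -/
def IsRun (A : ParityNTA rk Δ Q) (t : RTree rk) (ρ : List ℕ → Q) : Prop :=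
  ∀ w f, t.lab w = some f → A.trans (ρ w) f (fun j => ρ (w ++ [(j : ℕ)]))

/-- The accepting runs of `t` at state `p`: on every infinite path, the least color that occurs
infinitely often is even.  (The colors are bounded, so the `liminf` in `ℕ` is a genuine one.) -/
def Run (A : ParityNTA rk Δ Q) (t : RTree rk) (p : Q) : Set (List ℕ → Q) :=
  {ρ | A.IsRun t ρ ∧ ρ [] = p ∧
    ∀ α, IsInfinitePath t α → Even (liminf (fun k => A.color (ρ (α k))) atTop)}

/-- The language `L(A, p)` accepted at state `p`. -/
def language (A : ParityNTA rk Δ Q) (p : Q) : Set (RTree rk) :=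
  {t | t ∈ RTree.labeledIn rk Δ ∧ (A.Run t p).Nonempty}

end ParityNTA

/-! ### Function symbols, variables, holes and the symbol `⊥` -/

/-- A finite ranked set of symbols, each of which is a function symbol or a variable (or both),
together with a number of holes that bounds all ranks. -/
structure Signature where
  Sym : Type u
  finite_sym : Finite Sym
  rank : Sym → ℕ
  funs : Set Sym
  vars : Set Sym
  funs_union_vars : funs ∪ vars = Set.univ
  numHoles : ℕ
  rank_le : ∀ x, rank x ≤ numHoles

/-- Labels: symbols, holes, and `⊥`. -/
inductive Label (S : Signature.{u}) : Type u
  | sym (x : S.Sym) : Label S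
  | hole (i : Fin S.numHoles) : Label S
  | bot : Label S

/-- Holes and `⊥` have rank `0`. -/
def Label.rank {S : Signature.{u}} : Label S → ℕ
  | .sym x => S.rank x
  | .hole _ => 0
  | .bot => 0

/-- `Σ` as a set of labels. -/
def funLabels (S : Signature.{u}) : Set (Label S) := Label.sym '' S.funs

/-- `Σ ∪ X` as a set of labels. -/
def symLabels (S : Signature.{u}) : Set (Label S) := Label.sym '' (S.funs ∪ S.vars)

/-- `H` as a set of labels. -/
def holeLabels (S : Signature.{u}) : Set (Label S) := Set.range Label.hole

/-- The first `r` holes. -/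
def firstHoles (S : Signature.{u}) (r : ℕ) : Set (Label S) :=
  Label.hole '' {i | (i : ℕ) < r}

/-- All trees with labels in `Σ ∪ X ∪ H ∪ {⊥}`. -/
abbrev LTree (S : Signature.{u}) : Type u := RTree (Label.rank (S := S))

/-- `T(Δ)` for a set `Δ` of labels. -/
abbrev treesOver {S : Signature.{u}} (Δ : Set (Label S)) : Set (LTree S) := RTree.labeledIn Label.rank Δ

variable {S : Signature.{u}}

/-- The one-vertex tree whose vertex carries a label of rank `0`. -/
def leafTree (a : Label S) (ha : a.rank = 0) : LTree S where
  lab := fun w => if w = [] then some a else none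
  root_isSome := by simp
  child_iff := fun w i => by
    by_cases hw : w = [] <;> simp [hw, ha]

/-- The tree `⊥`. -/
def botTree : LTree S := leafTree Label.bot rfl

/-- The tree consisting of a single hole. -/
def holeTree (i : Fin S.numHoles) : LTree S := leafTree (Label.hole i) rfl

/-- The tree `f(1, …, rk f)`: root `f`, and the `i`-th child of the root is the `i`-th hole. -/
def basicTree (f : S.Sym) : LTree S where
  lab := fun w => match w with
    | [] => some (Label.sym f)
    | [i] => if h : i < S.rank f then some (Label.hole ⟨i, h.trans_le (S.rank_le f)⟩) else none
    | _ => none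
  root_isSome := by simp
  child_iff := fun w i => by
    match w with
    | [] => simp [Label.rank]
    | [j] => by_cases h : j < S.rank f <;> simp [h, Label.rank]
    | _ :: _ :: _ => simp

/-- No vertex is labeled by `⊥`. -/
def NoBot (t : LTree S) : Prop := ∀ w, t.lab w ≠ some Label.bot

/-! ### The metric, and the identification of all trees containing `⊥` with `⊥` -/

open Classical in
/-- The distance `2 ^ (-inf {|w| : s(w) ≠ t(w)})` if both or none of `s`, `t` contain `⊥`, and
`1` otherwise. -/
noncomputable def treeDist (s t : LTree S) : ℝ :=
  if s = t then 0
  else if NoBot s ↔ NoBot t then (1 / 2 : ℝ) ^ sInf (RTree.diffLevels s t) else 1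

theorem treeDist_nonneg (s t : LTree S) : 0 ≤ treeDist s t := by
  unfold treeDist; split_ifs <;> positivity

theorem treeDist_le_one (s t : LTree S) : treeDist s t ≤ 1 := by
  unfold treeDist
  split_ifs
  · norm_num
  · exact pow_le_one₀ (by norm_num) (by norm_num)
  · exact le_rfl

theorem treeDist_le_of_agree {s t : LTree S} (h : NoBot s ↔ NoBot t) (n : ℕ)
    (H : ∀ w : List ℕ, w.length < n → s.lab w = t.lab w) : treeDist s t ≤ (1 / 2 : ℝ) ^ n := by
  unfold treeDist
  split_ifs with h1
  · positivity
  · exact pow_le_pow_of_le_one (by norm_num) (by norm_num) ((RTree.le_sInf_diffLevels h1 n).1 H)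

theorem treeDist_ultra (s t r : LTree S) : treeDist s r ≤ max (treeDist s t) (treeDist t r) := by
  by_cases hst : s = t
  · subst hst; exact le_max_right _ _
  by_cases htr : t = r
  · subst htr; exact le_max_left _ _
  by_cases h1 : NoBot s ↔ NoBot t
  · by_cases h2 : NoBot t ↔ NoBot r
    · have e1 : treeDist s t = (1 / 2 : ℝ) ^ sInf (RTree.diffLevels s t) := by
        simp [treeDist, hst, h1]
      have e2 : treeDist t r = (1 / 2 : ℝ) ^ sInf (RTree.diffLevels t r) := by
        simp [treeDist, htr, h2]
      have a1 := (RTree.le_sInf_diffLevels hst _).2 le_rfl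
      have a2 := (RTree.le_sInf_diffLevels htr _).2 le_rfl
      rw [e1, e2]
      rcases le_total (sInf (RTree.diffLevels s t)) (sInf (RTree.diffLevels t r)) with hle | hle
      · refine le_trans (treeDist_le_of_agree (h1.trans h2) _ fun w hw => ?_) (le_max_left _ _)
        exact (a1 w hw).trans (a2 w (hw.trans_le hle))
      · refine le_trans (treeDist_le_of_agree (h1.trans h2) _ fun w hw => ?_) (le_max_right _ _)
        exact (a1 w (hw.trans_le hle)).trans (a2 w hw)
    · have e2 : treeDist t r = 1 := by simp [treeDist, htr, h2]
      rw [e2]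
      exact (treeDist_le_one s r).trans (le_max_right _ _)
  · have e1 : treeDist s t = 1 := by simp [treeDist, hst, h1]
    rw [e1]
    exact (treeDist_le_one s r).trans (le_max_left _ _)

noncomputable instance instMetricSpaceLTree : MetricSpace (LTree S) where
  dist := treeDist
  dist_self := fun s => by simp [treeDist]
  dist_comm := fun s t => by
    show treeDist s t = treeDist t s
    unfold treeDist
    rw [RTree.diffLevels_comm s t]
    congr 1
    · exact propext eq_comm
    · congr 1
      exact propext iff_comm
  dist_triangle := fun s t r =>
    (treeDist_ultra s t r).trans (max_le_add_of_nonneg (treeDist_nonneg _ _) (treeDist_nonneg _ _))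
  eq_of_dist_eq_zero := fun {s t} h => by
    change treeDist s t = 0 at h
    unfold treeDist at h
    split_ifs at h with h1 h2
    · exact h1
    · exact absurd h (by positivity)
    · norm_num at h

noncomputable instance instNonemptyLTree : Nonempty (LTree S) := ⟨botTree⟩

open Classical in
/-- The representative in `T(Σ ∪ X ∪ H) ∪ {⊥}`: every tree in which `⊥` occurs becomes `⊥`. -/
noncomputable def collapse (t : LTree S) : LTree S := if NoBot t then t else botTree

/-! ### Substitution into holes -/

/-- Labels of the tree obtained from the tree with labels `f` when every leaf labeled by a hole
`i` is replaced by the tree `τ i`. -/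
def substLab (τ : Fin S.numHoles → LTree S) :
    (List ℕ → Option (Label S)) → List ℕ → Option (Label S)
  | f, [] => match f [] with
    | some (Label.hole i) => (τ i).lab []
    | o => o
  | f, j :: w => match f [] with
    | some (Label.hole i) => (τ i).lab (j :: w)
    | _ => substLab τ (fun z => f (j :: z)) w

theorem substLab_append (τ : Fin S.numHoles → LTree S) (f : List ℕ → Option (Label S))
    (w z : List ℕ) (i : Fin S.numHoles) (hi : f w = some (Label.hole i))
    (hp : ∀ y, y <+: w → y ≠ w → ∀ k, f y ≠ some (Label.hole k)) :
    substLab τ f (w ++ z) = (τ i).lab z := by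
  induction w generalizing f with
  | nil => cases z <;> simp [substLab, hi]
  | cons j w ih =>
    have h0 : ∀ k, f [] ≠ some (Label.hole k) := hp [] (by simp) (by simp)
    have := ih (fun z => f (j :: z)) hi (fun y hy hne => hp (j :: y) (by simpa using hy)
      (by simpa using hne))
    rw [← this, List.cons_append, substLab]
    split
    · next k hk => exact absurd hk (h0 k)
    · rfl

theorem substLab_of_forall (τ : Fin S.numHoles → LTree S) (f : List ℕ → Option (Label S))
    (w : List ℕ) (hp : ∀ y, y <+: w → ∀ k, f y ≠ some (Label.hole k)) :
    substLab τ f w = f w := by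
  induction w generalizing f with
  | nil =>
    rw [substLab]
    split
    · next k hk => exact absurd hk (hp [] (by simp) k)
    · rfl
  | cons j w ih =>
    have h0 : ∀ k, f [] ≠ some (Label.hole k) := hp [] (by simp)
    rw [substLab]
    split
    · next k hk => exact absurd hk (h0 k)
    · exact ih (fun z => f (j :: z)) (fun y hy => hp (j :: y) (by simpa using hy))

theorem substLab_hole (τ : Fin S.numHoles → LTree S) (t : LTree S) (w z : List ℕ)
    (i : Fin S.numHoles) (hi : t.lab w = some (Label.hole i)) :
    substLab τ t.lab (w ++ z) = (τ i).lab z := by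
  refine substLab_append τ t.lab w z i hi fun y hy hne k hk => hne ?_
  obtain ⟨x, rfl⟩ := hy
  have := t.eq_nil_of_rank_zero y x _ hk rfl (by simp [hi])
  simp [this]

/-- The tree `t[iⱼ ← τ i]`. -/
def subst (t : LTree S) (τ : Fin S.numHoles → LTree S) : LTree S where
  lab := substLab τ t.lab
  root_isSome := by
    have h := t.root_isSome
    rw [substLab]
    split
    · next k hk => exact (τ k).root_isSome
    · exact h
  child_iff := fun w i => by
    by_cases hp : ∃ y, y <+: w ∧ ∃ k, t.lab y = some (Label.hole k)
    · obtain ⟨y, ⟨x, rfl⟩, k, hk⟩ := hp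
      rw [List.append_assoc, substLab_hole τ t y _ k hk, substLab_hole τ t y _ k hk]
      exact (τ k).child_iff x i
    · push Not at hp
      rw [substLab_of_forall τ t.lab w hp, ← t.child_iff]
      by_cases hk : ∃ k, t.lab (w ++ [i]) = some (Label.hole k)
      · obtain ⟨k, hk⟩ := hk
        have := substLab_hole τ t (w ++ [i]) [] k hk
        rw [List.append_nil] at this
        rw [this, hk]
        simp [(τ k).root_isSome]
      · push Not at hk
        rw [substLab_of_forall]
        intro y hy
        rcases List.prefix_concat_iff.1 hy with rfl | hy
        · exact hk
        · exact hp y hy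

/-! ### Choice functions -/

/-- `γ` is a choice function for `s ∈ T(Σ ∪ X)`.  (Only its values on positions of `s` matter.) -/
def IsChoiceFunction (s : LTree S) (γ : List ℕ → LTree S) : Prop :=
  ∀ w x, s.lab w = some (Label.sym x) →
    (γ w = botTree ∨
      (γ w ∈ treesOver (funLabels S ∪ firstHoles S (S.rank x)) ∧ ∀ i, γ w ≠ holeTree i)) ∧
    (x ∈ S.funs \ S.vars → γ w = basicTree x)

/-- The sequence `γ₀(s) = γ(ε)`, `γₙ₊₁(s) = γ(ε)[iⱼ ← (γ|ᵢ)ₙ(s|ᵢ)]`, where `γ|ᵢ(w) = γ(i.w)`.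
It depends on `s` only through the restriction of `γ` to the positions of `s`: only holes
`i < rk (s(ε))` occur in `γ(ε)`, and `s|ᵢ` is the subtree at the position `i` of `s`. -/
def gammaN : ℕ → (List ℕ → LTree S) → LTree S
  | 0, γ => γ []
  | n + 1, γ => subst (γ []) (fun i => gammaN n (fun w => γ ((i : ℕ) :: w)))

/-- `γ_∞(s)`: the limit of `γₙ(s)` in the metric space `T(Σ ∪ X ∪ H) ∪ {⊥}`. -/
noncomputable def gammaInf (γ : List ℕ → LTree S) : LTree S :=
  limUnder atTop (fun n => collapse (gammaN n γ))

theorem gammaN_succ_lab (n : ℕ) (γ : List ℕ → LTree S) (w : List ℕ) (a : Label S)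
    (ha : ∀ k, a ≠ Label.hole k) (h : (gammaN n γ).lab w = some a) :
    (gammaN (n + 1) γ).lab w = some a := by
  induction n generalizing γ w with
  | zero =>
    change substLab _ (γ []).lab w = some a
    change (γ []).lab w = some a at h
    rw [substLab_of_forall, h]
    rintro y ⟨x, rfl⟩ k hk
    have := (γ []).eq_nil_of_rank_zero y x _ hk rfl (by simp [h])
    subst this
    rw [List.append_nil, hk] at h
    exact ha k (by simpa using h.symm)
  | succ n ih =>
    change substLab _ (γ []).lab w = some a
    change substLab _ (γ []).lab w = some a at h
    by_cases hp : ∃ y, y <+: w ∧ ∃ k, (γ []).lab y = some (Label.hole k)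
    · obtain ⟨y, ⟨x, rfl⟩, k, hk⟩ := hp
      rw [substLab_hole _ _ y x k hk] at h ⊢
      exact ih _ _ h
    · push Not at hp
      rw [substLab_of_forall _ _ w hp] at h ⊢
      exact h

theorem root_ne_hole (s : LTree S) (γ : List ℕ → LTree S) (hγ : IsChoiceFunction s γ) (x : S.Sym)
    (hx : s.lab [] = some (Label.sym x)) (k : Fin S.numHoles) :
    (γ []).lab [] ≠ some (Label.hole k) := by
  intro hk
  rcases (hγ [] x hx).1 with hb | ⟨-, hne⟩
  · rw [hb] at hk
    simp [botTree, leafTree] at hk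
  · apply hne k
    ext1
    funext z
    by_cases hz : (γ []).lab z = none
    · have : z ≠ [] := by rintro rfl; simp [hk] at hz
      simp [holeTree, leafTree, this, hz]
    · have := (γ []).eq_nil_of_rank_zero [] z _ hk rfl
        (by simpa [Option.isSome_iff_ne_none] using hz)
      subst this
      simp [holeTree, leafTree, hk]

theorem gammaN_agree (n : ℕ) (s : LTree S) (hs : s ∈ treesOver (symLabels S))
    (γ : List ℕ → LTree S) (hγ : IsChoiceFunction s γ) (w : List ℕ) (hw : w.length < n + 1) :
    (gammaN (n + 1) γ).lab w = (gammaN n γ).lab w := by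
  obtain ⟨a, ha⟩ := Option.isSome_iff_exists.1 s.root_isSome
  obtain ⟨x, -, rfl⟩ := hs _ _ ha
  have hroot := root_ne_hole s γ hγ x ha
  induction n generalizing s γ w x with
  | zero =>
    have : w = [] := List.eq_nil_of_length_eq_zero (by omega)
    subst this
    change substLab _ (γ []).lab [] = (γ []).lab []
    apply substLab_of_forall
    intro y hy
    rw [List.prefix_nil.1 hy]
    exact hroot
  | succ n ih =>
    change substLab _ (γ []).lab w = substLab _ (γ []).lab w
    by_cases hp : ∃ y, y <+: w ∧ ∃ k, (γ []).lab y = some (Label.hole k)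
    · obtain ⟨y, ⟨z, rfl⟩, k, hk⟩ := hp
      rw [substLab_hole _ _ y z k hk, substLab_hole _ _ y z k hk]
      have hy : y ≠ [] := by rintro rfl; exact hroot k hk
      have hkx : (k : ℕ) < S.rank x := by
        rcases (hγ [] x ha).1 with hb | ⟨hT, -⟩
        · rw [hb] at hk
          simp [botTree, leafTree, hy] at hk
        · rcases hT _ _ hk with ⟨f, -, hf⟩ | ⟨i, hi, he⟩
          · exact absurd hf (by simp)
          · cases he
            exact hi
      have hpos : [(k : ℕ)] ∈ s.Pos := (s.child_iff [] k).2 ⟨_, ha, hkx⟩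
      have hs' : s.subtree [(k : ℕ)] hpos ∈ treesOver (symLabels S) := fun _ _ h => hs _ _ h
      have hγ' : IsChoiceFunction (s.subtree [(k : ℕ)] hpos) (fun w => γ ((k : ℕ) :: w)) :=
        fun w x h => hγ ((k : ℕ) :: w) x h
      obtain ⟨b, hb⟩ := Option.isSome_iff_exists.1 (s.subtree [(k : ℕ)] hpos).root_isSome
      obtain ⟨x', -, rfl⟩ := hs' _ _ hb
      have hlen : z.length < n + 1 := by
        have := List.length_pos_iff.2 hy
        simp at hw
        omega
      exact ih _ hs' _ hγ' z hlen x' hb (root_ne_hole _ _ hγ' x' hb)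
    · push Not at hp
      rw [substLab_of_forall _ _ w hp, substLab_of_forall _ _ w hp]

theorem gammaN_agree_le {n m : ℕ} (hnm : n ≤ m) (s : LTree S) (hs : s ∈ treesOver (symLabels S))
    (γ : List ℕ → LTree S) (hγ : IsChoiceFunction s γ) (w : List ℕ) (hw : w.length < n + 1) :
    (gammaN m γ).lab w = (gammaN n γ).lab w := by
  induction m, hnm using Nat.le_induction with
  | base => rfl
  | succ m hm ih => rw [gammaN_agree m s hs γ hγ w (by omega), ih]

/-- For a choice function the sequence `γₙ(s)` converges, so `gammaInf` is really its limit. -/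
theorem tendsto_gammaN (s : LTree S) (hs : s ∈ treesOver (symLabels S))
    (γ : List ℕ → LTree S) (hγ : IsChoiceFunction s γ) :
    Tendsto (fun n => collapse (gammaN n γ)) atTop (𝓝 (gammaInf γ)) := by
  apply tendsto_nhds_limUnder
  by_cases hall : ∀ n, NoBot (gammaN n γ)
  · refine ⟨⟨fun w => (gammaN w.length γ).lab w, (gammaN 0 γ).root_isSome, fun w i => ?_⟩, ?_⟩
    · rw [(gammaN (w ++ [i]).length γ).child_iff,
        gammaN_agree_le (n := w.length) (by simp) s hs γ hγ w (by omega)]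
    · rw [tendsto_iff_dist_tendsto_zero]
      have hlim : Tendsto (fun n : ℕ => (1 / 2 : ℝ) ^ n) atTop (𝓝 0) :=
        tendsto_pow_atTop_nhds_zero_of_lt_one (by norm_num) (by norm_num)
      refine squeeze_zero (fun _ => dist_nonneg) (fun n => ?_) hlim
      simp only [collapse, hall n, if_true]
      change treeDist _ _ ≤ _
      refine treeDist_le_of_agree (iff_of_true (hall n) fun w => hall w.length w) n
        fun w hw => ?_
      exact gammaN_agree_le (by omega) s hs γ hγ w (by omega)
  · push Not at hall
    obtain ⟨n, hn⟩ := hall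
    simp only [NoBot, not_forall, not_not] at hn
    obtain ⟨w, hw⟩ := hn
    refine ⟨botTree, tendsto_const_nhds.congr' ?_⟩
    filter_upwards [eventually_ge_atTop n] with m hm
    have : (gammaN m γ).lab w = some Label.bot := by
      induction m, hm using Nat.le_induction with
      | base => exact hw
      | succ m hm ih => exact gammaN_succ_lab m γ w _ (by simp) ih
    have hnb : ¬ NoBot (gammaN m γ) := fun h => h w this
    simp [collapse, hnb]

/-! ### Tasks and profiles -/

/-- The best-ordering `0 ⪯ 2 ⪯ 4 ⪯ ⋯ ⪯ 5 ⪯ 3 ⪯ 1`. -/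
def BestLE (a b : ℕ) : Prop :=
  (Even a ∧ Even b ∧ a ≤ b) ∨ (Even a ∧ Odd b) ∨ (Odd a ∧ Odd b ∧ b ≤ a)

namespace ParityNTA

variable {Q : Type v}

/-- The automaton `B_H` over `Σ ∪ H`: every hole is accepted at every state. -/
def withHoles (B : ParityNTA (Label.rank (S := S)) (funLabels S) Q) :
    ParityNTA (Label.rank (S := S)) (funLabels S ∪ holeLabels S) Q where
  trans := fun p f ps => B.trans p f ps ∨ f ∈ holeLabels S
  trans_mem := fun p f ps h => h.imp (B.trans_mem p f ps) id
  numColors := B.numColors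
  odd_numColors := B.odd_numColors
  color := B.color
  color_mem := B.color_mem

/-- A task `(p, ψ₁, …, ψ_|H|)` with `ψᵢ : Q → {0} ∪ χ(Q)`. -/
structure Task (B : ParityNTA (Label.rank (S := S)) (funLabels S) Q) where
  state : Q
  bound : Fin S.numHoles → Q → ℕ
  bound_mem : ∀ i q, bound i q ∈ insert 0 (Set.range B.color)

/-- The minimal color on the path from the root to the position `w`. -/
noncomputable def minColor (B : ParityNTA (Label.rank (S := S)) (funLabels S) Q)
    (ρ : List ℕ → Q) (w : List ℕ) : ℕ :=
  sInf {c | ∃ y, y <+: w ∧ c = B.color (ρ y)}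

/-- The run `ρ` of `t` satisfies the task `τ`. -/
def RunSatisfies (B : ParityNTA (Label.rank (S := S)) (funLabels S) Q)
    (t : LTree S) (ρ : List ℕ → Q) (τ : B.Task) : Prop :=
  ∀ i w, t.lab w = some (Label.hole i) → BestLE (B.minColor ρ w) (τ.bound i (ρ w))

/-- `t ⊨ τ`. -/
def Satisfies (B : ParityNTA (Label.rank (S := S)) (funLabels S) Q)
    (t : LTree S) (τ : B.Task) : Prop :=
  ∃ ρ ∈ B.withHoles.Run t τ.state, B.RunSatisfies t ρ τ

/-- The profile `π(t)`. -/
def profile (B : ParityNTA (Label.rank (S := S)) (funLabels S) Q) (t : LTree S) : Set B.Task :=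
  {τ | B.Satisfies t τ}

/-- The relation `t ≡_B t'`. -/
def TaskEquiv (B : ParityNTA (Label.rank (S := S)) (funLabels S) Q) (t t' : LTree S) : Prop :=
  B.profile t = B.profile t'

end ParityNTA

end IOSubst

open IOSubst

namespace IOSubst

/-! ### Lower limits of bounded sequences of natural numbers -/

/-! The hypotheses are symmetric in `γ` and `γ'`, so it is enough to turn an accepting run `ρ` of
`γ_∞(s)` into one of `γ'_∞(s)`. The tree `γ_∞(s)` is composed of copies of the trees `γ(u)`, and the
restriction of `ρ` to the copy with root `x` is a run of `γ(u)` with holes. It satisfies the task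
that allows, for each hole and state, the ⪯-worst minimal color that actually occurs. Equivalence
yields a run `σ x` of `γ'(u)` for the same task, so every hole leaf of `γ'(u)` has a partner leaf in
`γ(u)` with the same hole, the same state and a color at least as bad (`TaskEquiv.exists_run`).

The runs `σ x` are glued along partner leaves: below the leaf `v` of the copy attached to `x`, the
run continues with that of the copy at `x ++ leaf x v`. Equal hole numbers keep both sides at the
same position of `s` (`track_spec`), and equal states make the glued map a run
(`trans_of_filledLab`). Several copies of `γ'(u)` may be attached to one copy of `γ(u)`.

A path that finally stays in one copy is accepted because `σ x` is accepting. Otherwise the partner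
leaves trace an infinite path of `γ_∞(s)`, since no root is a hole. The two paths, cut at the copy
boundaries, have blockwise minima that compare under ⪯, and even lower limits pass to the ⪯-better
sequence (`even_liminf_of_bestLE`). The symbol ⊥ cannot occur on either side, as `B` has no
transition for it. -/

theorem exists_eventually_ge_frequently_le {a : ℕ → ℕ} {N : ℕ} (ha : ∀ k, a k ≤ N) :
    ∃ c, (∀ᶠ k in atTop, c ≤ a k) ∧ ∃ᶠ k in atTop, a k ≤ c := by
  classical
  have hex : ∃ c, ∃ᶠ k in atTop, a k ≤ c := ⟨N, Frequently.of_forall ha⟩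
  refine ⟨Nat.find hex, ?_, Nat.find_spec hex⟩
  rcases hc : Nat.find hex with _ | c
  · exact Eventually.of_forall fun _ => Nat.zero_le _
  · have := Nat.find_min hex (m := c) (by omega)
    rw [not_frequently] at this
    exact this.mono fun k hk => by omega

theorem liminf_eq_of_eventually_ge_of_frequently_le {a : ℕ → ℕ} {c : ℕ}
    (h1 : ∀ᶠ k in atTop, c ≤ a k) (h2 : ∃ᶠ k in atTop, a k ≤ c) :
    liminf a atTop = c := by
  apply le_antisymm
  · exact liminf_le_of_frequently_le h2 ⟨c, h1⟩
  · exact le_liminf_of_le (IsCoboundedUnder.of_frequently_le h2) h1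

/-- The minima of a bounded sequence over consecutive intervals have the same lower limit as the
sequence itself. -/
theorem liminf_sInf_image_Icc {a : ℕ → ℕ} {N : ℕ} (ha : ∀ k, a k ≤ N) {n : ℕ → ℕ}
    (hn : StrictMono n) :
    liminf (fun i => sInf (a '' Set.Icc (n i) (n (i + 1)))) atTop = liminf a atTop := by
  obtain ⟨c, h1, h2⟩ := exists_eventually_ge_frequently_le ha
  rw [liminf_eq_of_eventually_ge_of_frequently_le h1 h2]
  apply liminf_eq_of_eventually_ge_of_frequently_le
  · obtain ⟨K, hK⟩ := eventually_atTop.1 h1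
    filter_upwards [eventually_ge_atTop K] with i hi
    obtain ⟨k, ⟨hk, -⟩, e⟩ := Nat.sInf_mem (s := a '' Set.Icc (n i) (n (i + 1)))
      ⟨_, n i, ⟨le_rfl, hn.monotone (Nat.le_succ i)⟩, rfl⟩
    rw [← e]
    exact hK k (hi.trans ((hn.id_le i).trans hk))
  · rw [frequently_atTop] at h2 ⊢
    intro K
    obtain ⟨k, hk, hkc⟩ := h2 (n K)
    -- The block that contains `k` ends at the first `n i` beyond `k`.
    have hex : ∃ i, k < n i := ⟨k + 1, (Nat.lt_succ_self k).trans_le (hn.id_le _)⟩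
    classical
    have hlt := Nat.find_spec hex
    have hK : K < Nat.find hex := by
      by_contra hcon
      have := hn.monotone (not_lt.1 hcon)
      omega
    obtain ⟨i, hi⟩ : ∃ i, Nat.find hex = i + 1 := ⟨Nat.find hex - 1, by omega⟩
    have hle := Nat.find_min hex (m := i) (by omega)
    rw [hi] at hlt
    exact ⟨i, by omega, (Nat.sInf_le (Set.mem_image_of_mem a
      (show k ∈ Set.Icc (n i) (n (i + 1)) from ⟨by omega, hlt.le⟩))).trans hkc⟩

/-- Let `c` and `c'` be the lower limits of `m` and `m'`, with `c` even, and suppose `c'` is odd.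
Where `m` takes the value `c`, the better `m'` is even and at most `c`, so `c' ≤ c`. Where `m'`
takes the value `c'`, the worse `m` is odd and at most `c'`, so `c ≤ c'`. Hence `c = c'`, a
contradiction. -/
theorem even_liminf_of_bestLE {m m' : ℕ → ℕ} {N : ℕ} (hm : ∀ i, m i ≤ N) (hm' : ∀ i, m' i ≤ N)
    (h : ∀ i, BestLE (m' i) (m i)) (he : Even (liminf m atTop)) : Even (liminf m' atTop) := by
  obtain ⟨c, h1, h2⟩ := exists_eventually_ge_frequently_le hm
  obtain ⟨c', h1', h2'⟩ := exists_eventually_ge_frequently_le hm'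
  rw [liminf_eq_of_eventually_ge_of_frequently_le h1 h2] at he
  rw [liminf_eq_of_eventually_ge_of_frequently_le h1' h2']
  by_contra ho
  obtain ⟨i, hi, hi1, hi1'⟩ := (h2.and_eventually (h1.and h1')).exists
  obtain ⟨j, hj, hj1, hj1'⟩ := (h2'.and_eventually (h1.and h1')).exists
  have ei : m i = c := le_antisymm hi hi1
  have ej : m' j = c' := le_antisymm hj hj1'
  have bi := h i
  have bj := h j
  unfold BestLE at bi bj
  rw [ei] at bi
  rw [ej] at bj
  simp only [← Nat.not_even_iff_odd] at bi bj
  have : m' i ≤ c := by tauto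
  have : m j ≤ c' := by tauto
  have hcc : c = c' := by omega
  exact ho (hcc ▸ he)

/-- The ⪯-worst element is the least odd one, or the greatest element if all are even. -/
theorem exists_bestLE_max {A : Set ℕ} (hA : A.Nonempty) {N : ℕ} (hN : ∀ a ∈ A, a ≤ N) :
    ∃ m ∈ A, ∀ a ∈ A, BestLE a m := by
  classical
  by_cases hodd : ∃ a, a ∈ A ∧ Odd a
  · refine ⟨Nat.find hodd, (Nat.find_spec hodd).1, fun a ha => ?_⟩
    rcases Nat.even_or_odd a with h | h
    · exact Or.inr (Or.inl ⟨h, (Nat.find_spec hodd).2⟩)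
    · exact Or.inr (Or.inr ⟨h, (Nat.find_spec hodd).2, Nat.find_min' hodd ⟨ha, h⟩⟩)
  · have hev : ∀ a ∈ A, Even a := fun a ha => by
      rw [← Nat.not_odd_iff_even]
      exact fun h => hodd ⟨a, ha, h⟩
    have hb : BddAbove A := ⟨N, hN⟩
    exact ⟨sSup A, Nat.sSup_mem hA hb, fun a ha =>
      Or.inl ⟨hev a ha, hev _ (Nat.sSup_mem hA hb), le_csSup hb ha⟩⟩

/-! ### Locating positions in nested trees -/

variable {S : Signature.{u}} {K : Type*}

/-- One step downwards in a tree that is composed of the trees `T k`: the pair `(k, v)` stands for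
the position `v` of the copy `k`, and a hole `i` at the position `v` of the copy `k` is filled with
the copy `next k v i`. -/
def stepDown (T : K → LTree S) (next : K → List ℕ → Fin S.numHoles → K) (p : K × List ℕ) (j : ℕ) :
    K × List ℕ :=
  match (T p.1).lab (p.2 ++ [j]) with
  | some (Label.hole i) => (next p.1 (p.2 ++ [j]) i, [])
  | _ => (p.1, p.2 ++ [j])

theorem stepDown_of_hole {T : K → LTree S} {next : K → List ℕ → Fin S.numHoles → K}
    {p : K × List ℕ} {j : ℕ} {i : Fin S.numHoles}
    (h : (T p.1).lab (p.2 ++ [j]) = some (Label.hole i)) :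
    stepDown T next p j = (next p.1 (p.2 ++ [j]) i, []) := by
  simp [stepDown, h]

theorem stepDown_of_ne_hole {T : K → LTree S} {next : K → List ℕ → Fin S.numHoles → K}
    {p : K × List ℕ} {j : ℕ} (h : ∀ i, (T p.1).lab (p.2 ++ [j]) ≠ some (Label.hole i)) :
    stepDown T next p j = (p.1, p.2 ++ [j]) := by
  unfold stepDown
  split
  · next i hi => exact absurd hi (h i)
  · rfl

theorem foldl_stepDown_of_ne_hole {T : K → LTree S} {next : K → List ℕ → Fin S.numHoles → K}
    (k : K) (v z : List ℕ)
    (h : ∀ y, y <+: z → y ≠ [] → ∀ i, (T k).lab (v ++ y) ≠ some (Label.hole i)) :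
    z.foldl (stepDown T next) (k, v) = (k, v ++ z) := by
  induction z using List.reverseRecOn with
  | nil => simp
  | append_singleton z j ih =>
    rw [List.foldl_append, ih fun y hy => h y (hy.trans (List.prefix_append _ _))]
    simp only [List.foldl_cons, List.foldl_nil]
    rw [stepDown_of_ne_hole]
    · simp
    · intro i
      simpa using h (z ++ [j]) List.prefix_rfl (by simp) i

theorem RTree.lab_ne_hole_of_prefix (t : LTree S) {y z : List ℕ} (hy : y <+: z) (hne : y ≠ z)
    (hz : (t.lab z).isSome) (i : Fin S.numHoles) : t.lab y ≠ some (Label.hole i) := by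
  obtain ⟨x, rfl⟩ := hy
  intro h
  have := t.eq_nil_of_rank_zero y x _ h rfl hz
  simp [this] at hne

/-- Holes are leaves, so no hole is met before the last letter of `z`. The word must be nonempty
because the jump happens only when a step is made. -/
theorem foldl_stepDown_of_hole {T : K → LTree S} {next : K → List ℕ → Fin S.numHoles → K}
    (k : K) (v z : List ℕ) (hz : z ≠ []) (i : Fin S.numHoles)
    (h : (T k).lab (v ++ z) = some (Label.hole i)) :
    z.foldl (stepDown T next) (k, v) = (next k (v ++ z) i, []) := by
  induction z using List.reverseRecOn with
  | nil => exact absurd rfl hz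
  | append_singleton z j _ =>
    rw [List.foldl_append, foldl_stepDown_of_ne_hole k v z]
    · simp only [List.foldl_cons, List.foldl_nil]
      rw [stepDown_of_hole (i := i) (by simpa using h)]
      simp
    · intro y hy _ l
      refine (T k).lab_ne_hole_of_prefix (z := v ++ (z ++ [j])) ?_ ?_ (by simp [h]) l
      · exact (List.prefix_append_right_inj v).2 (hy.trans (List.prefix_append _ _))
      · intro e
        have := hy.length_le
        have := congrArg List.length (List.append_cancel_left e)
        simp at this
        omega

/-- Along an infinite path, every copy that is entered and left again is crossed along a path to
one of its holes. -/
theorem exists_crossing {T : K → LTree S} {next : K → List ℕ → Fin S.numHoles → K}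
    {q : ℕ → K × List ℕ} (hstep : ∀ m, ∃ j, q (m + 1) = stepDown T next (q m) j) {n : ℕ}
    (hn : (q n).2 = []) (hex : ∃ n' > n, (q n').2 = []) :
    ∃ V i, V ≠ [] ∧ (T (q n).1).lab V = some (Label.hole i) ∧
      q (n + V.length) = (next (q n).1 V i, []) ∧
      ∀ k < V.length, q (n + k) = ((q n).1, V.take k) := by
  classical
  obtain ⟨hlt, hnil⟩ := Nat.find_spec hex
  have hmin : ∀ m, n < m → m < Nat.find hex → (q m).2 ≠ [] := fun m h1 h2 h3 =>
    Nat.find_min hex h2 ⟨h1, h3⟩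
  -- The next entry takes `l` steps inside the copy and one step into a hole.
  obtain ⟨l, hl⟩ : ∃ l, Nat.find hex = n + l + 1 := ⟨Nat.find hex - n - 1, by omega⟩
  rw [hl] at hnil hmin
  have key : ∀ m ≤ l, ∃ v : List ℕ, v.length = m ∧ ∀ k ≤ m, q (n + k) = ((q n).1, v.take k) := by
    intro m
    induction m with
    | zero =>
      intro _
      refine ⟨[], rfl, fun k hk => ?_⟩
      obtain rfl : k = 0 := by omega
      simp [← hn]
    | succ m ih =>
      intro hm
      obtain ⟨v, hv, hq⟩ := ih (by omega)
      obtain ⟨j, hj⟩ := hstep (n + m)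
      have hne := hmin (n + (m + 1)) (by omega) (by omega)
      have hnh : ∀ i, (T (q (n + m)).1).lab ((q (n + m)).2 ++ [j]) ≠ some (Label.hole i) := by
        intro i hi
        rw [← add_assoc, hj, stepDown_of_hole hi] at hne
        exact hne rfl
      rw [stepDown_of_ne_hole hnh, hq m le_rfl, ← hv, List.take_length] at hj
      refine ⟨v ++ [j], by simp [hv], fun k hk => ?_⟩
      rcases Nat.lt_or_ge m k with h | h
      · obtain rfl : k = m + 1 := by omega
        rw [← add_assoc, ← hv, hj, List.take_of_length_le (by simp)]
      · rw [hq k h, List.take_append_of_le_length (by omega)]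
  obtain ⟨v, hv, hq⟩ := key l le_rfl
  obtain ⟨j, hj⟩ := hstep (n + l)
  rw [hj, hq l le_rfl, ← hv, List.take_length] at hnil
  have hh : ∃ i, (T (q n).1).lab (v ++ [j]) = some (Label.hole i) := by
    by_contra hcon
    push Not at hcon
    rw [stepDown_of_ne_hole hcon] at hnil
    simp at hnil
  obtain ⟨i, hi⟩ := hh
  refine ⟨v ++ [j], i, by simp, hi, ?_, fun k hk => ?_⟩
  · rw [List.length_append, List.length_singleton, ← add_assoc, hv, hj, hq l le_rfl, ← hv,
      List.take_length, stepDown_of_hole hi]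
  · simp only [List.length_append, List.length_singleton] at hk
    rw [hq k (by omega), List.take_append_of_le_length (by omega)]

end IOSubst

namespace IOSubst
variable {S : Signature.{u}}

/-! ### The labels of `γ_∞(s)` -/

/-- The pair `(u, v)` such that the position `w` of `γ_∞(s)` is the position `v` of a copy
of `γ(u)`. -/
def locate (γ : List ℕ → LTree S) (w : List ℕ) : List ℕ × List ℕ :=
  w.foldl (stepDown γ (fun u _ i => u ++ [(i : ℕ)])) ([], [])

/-- The label of `γ_∞(s)` at `w`, as long as `⊥` does not occur. -/
def filledLab (γ : List ℕ → LTree S) (w : List ℕ) : Option (Label S) :=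
  (γ (locate γ w).1).lab (locate γ w).2

theorem locate_append (γ : List ℕ → LTree S) (w z : List ℕ) :
    locate γ (w ++ z) =
      z.foldl (stepDown γ (fun u _ i => u ++ [(i : ℕ)])) (locate γ w) := by
  simp [locate, List.foldl_append]

theorem locate_append_singleton (γ : List ℕ → LTree S) (w : List ℕ) (j : ℕ) :
    locate γ (w ++ [j]) = stepDown γ (fun u _ i => u ++ [(i : ℕ)]) (locate γ w) j := by
  simp [locate_append]

/-- Makes the top-down walk compatible with the recursion of `gammaN`, which passes to the shifted
choice function. -/
theorem foldl_stepDown_cons (γ : List ℕ → LTree S) (k : ℕ) (z : List ℕ) (p : List ℕ × List ℕ) :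
    z.foldl (stepDown γ (fun u _ i => u ++ [(i : ℕ)])) (k :: p.1, p.2) =
      (k :: (z.foldl (stepDown (fun w => γ (k :: w)) (fun u _ i => u ++ [(i : ℕ)])) p).1,
        (z.foldl (stepDown (fun w => γ (k :: w)) (fun u _ i => u ++ [(i : ℕ)])) p).2) := by
  induction z generalizing p with
  | nil => rfl
  | cons j z ih =>
    simp only [List.foldl_cons]
    rw [← ih]
    congr 1
    by_cases h : ∃ i, (γ (k :: p.1)).lab (p.2 ++ [j]) = some (Label.hole i)
    · obtain ⟨i, hi⟩ := h
      rw [stepDown_of_hole (i := i) hi, stepDown_of_hole (i := i) hi]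
      rfl
    · push Not at h
      rw [stepDown_of_ne_hole h, stepDown_of_ne_hole h]

section ChoiceFunction

variable {s : LTree S} {γ : List ℕ → LTree S}

theorem IsChoiceFunction.subtree (hγ : IsChoiceFunction s γ) (w : List ℕ) (hw : w ∈ s.Pos) :
    IsChoiceFunction (s.subtree w hw) (fun z => γ (w ++ z)) :=
  fun z x h => hγ (w ++ z) x h

theorem IsChoiceFunction.root_ne_hole (hs : s ∈ treesOver (symLabels S))
    (hγ : IsChoiceFunction s γ) {w : List ℕ} (hw : w ∈ s.Pos) (k : Fin S.numHoles) :
    (γ w).lab [] ≠ some (Label.hole k) := by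
  obtain ⟨a, ha⟩ := Option.isSome_iff_exists.1 hw
  obtain ⟨x, -, rfl⟩ := hs _ _ ha
  have := IOSubst.root_ne_hole _ _ (hγ.subtree w hw) x (by simpa [RTree.subtree] using ha) k
  simpa using this

theorem IsChoiceFunction.append_mem_pos (hs : s ∈ treesOver (symLabels S))
    (hγ : IsChoiceFunction s γ) {w v : List ℕ} (hw : w ∈ s.Pos) {k : Fin S.numHoles}
    (hk : (γ w).lab v = some (Label.hole k)) : w ++ [(k : ℕ)] ∈ s.Pos := by
  obtain ⟨a, ha⟩ := Option.isSome_iff_exists.1 hw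
  obtain ⟨x, -, rfl⟩ := hs _ _ ha
  refine (s.child_iff w k).2 ⟨_, ha, ?_⟩
  rcases (hγ w x ha).1 with hb | ⟨hT, -⟩
  · rw [hb] at hk
    simp [botTree, leafTree] at hk
  · rcases hT _ _ hk with ⟨f, -, hf⟩ | ⟨i, hi, he⟩
    · exact absurd hf (by simp)
    · cases he
      exact hi

theorem IsChoiceFunction.locate_fst_mem (hs : s ∈ treesOver (symLabels S))
    (hγ : IsChoiceFunction s γ) (w : List ℕ) : (locate γ w).1 ∈ s.Pos := by
  induction w using List.reverseRecOn with
  | nil => exact s.root_isSome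
  | append_singleton w j ih =>
    rw [locate_append_singleton]
    by_cases h : ∃ i, (γ (locate γ w).1).lab ((locate γ w).2 ++ [j]) = some (Label.hole i)
    · obtain ⟨i, hi⟩ := h
      rw [stepDown_of_hole hi]
      exact hγ.append_mem_pos hs ih hi
    · push Not at h
      rw [stepDown_of_ne_hole h]
      exact ih

/-- A hole that is reached is replaced at once by the root of the next tree, and that root is not a
hole. -/
theorem IsChoiceFunction.filledLab_ne_hole (hs : s ∈ treesOver (symLabels S))
    (hγ : IsChoiceFunction s γ) (w : List ℕ) (k : Fin S.numHoles) :
    filledLab γ w ≠ some (Label.hole k) := by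
  induction w using List.reverseRecOn with
  | nil => exact hγ.root_ne_hole hs s.root_isSome k
  | append_singleton w j _ =>
    unfold filledLab
    rw [locate_append_singleton]
    by_cases h : ∃ i, (γ (locate γ w).1).lab ((locate γ w).2 ++ [j]) = some (Label.hole i)
    · obtain ⟨i, hi⟩ := h
      rw [stepDown_of_hole hi]
      exact hγ.root_ne_hole hs (hγ.append_mem_pos hs (hγ.locate_fst_mem hs w) hi) k
    · push Not at h
      rw [stepDown_of_ne_hole h]
      exact h k

/-- Every passage through a hole consumes a letter, because roots are not holes; hence `n` rounds of
substitution settle all labels up to depth `n`. -/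
theorem IsChoiceFunction.gammaN_lab (hs : s ∈ treesOver (symLabels S))
    (hγ : IsChoiceFunction s γ) {n : ℕ} {w : List ℕ} (hw : w.length ≤ n) :
    (gammaN n γ).lab w = filledLab γ w := by
  induction n generalizing s γ w with
  | zero =>
    obtain rfl : w = [] := List.eq_nil_of_length_eq_zero (by omega)
    rfl
  | succ n ih =>
    change substLab _ (γ []).lab w = _
    have hroot := hγ.root_ne_hole hs s.root_isSome
    by_cases hp : ∃ y, y <+: w ∧ ∃ k, (γ []).lab y = some (Label.hole k)
    · obtain ⟨y, ⟨z, rfl⟩, k, hk⟩ := hp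
      have hy : y ≠ [] := by rintro rfl; exact hroot k hk
      have hpos := hγ.append_mem_pos hs s.root_isSome hk
      rw [substLab_hole _ _ y z k hk, ih (s := s.subtree _ hpos) (γ := fun w => γ ((k : ℕ) :: w)) (fun _ _ h => hs _ _ h)
        (hγ.subtree _ hpos)]
      · unfold filledLab
        have h1 : locate γ y = ([(k : ℕ)], []) :=
          foldl_stepDown_of_hole (next := fun u _ i => u ++ [(i : ℕ)]) [] [] y hy k hk
        rw [locate_append, h1]
        have := foldl_stepDown_cons γ k z ([], [])
        simp only at this
        rw [this]
        rfl
      · have := List.length_pos_iff.2 hy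
        simp at hw
        omega
    · push Not at hp
      rw [substLab_of_forall _ _ w hp]
      unfold filledLab
      have : locate γ w = ([], w) :=
        foldl_stepDown_of_ne_hole (next := fun u _ i => u ++ [(i : ℕ)]) [] [] w
          fun y hy _ => hp y hy
      rw [this]

theorem gammaN_lab_of_le {m n : ℕ} (hmn : n ≤ m) (γ : List ℕ → LTree S) (w : List ℕ) (a : Label S)
    (ha : ∀ k, a ≠ Label.hole k) (h : (gammaN n γ).lab w = some a) :
    (gammaN m γ).lab w = some a := by
  induction m, hmn using Nat.le_induction with
  | base => exact h
  | succ m _ ih => exact gammaN_succ_lab m γ w a ha ih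

theorem IsChoiceFunction.gammaInf_lab (hs : s ∈ treesOver (symLabels S))
    (hγ : IsChoiceFunction s γ) (hb : ∀ w, filledLab γ w ≠ some Label.bot) (w : List ℕ) :
    (gammaInf γ).lab w = filledLab γ w := by
  -- Below depth `n` the tree `gammaN n γ` need not be final, but labels other than holes persist,
  -- so a ⊥ at `z` would still be there at a stage beyond the length of `z`.
  have hall : ∀ n, NoBot (gammaN n γ) := by
    intro n z hz
    apply hb z
    rw [← hγ.gammaN_lab hs (le_max_right n z.length)]
    exact gammaN_lab_of_le (le_max_left _ _) γ z _ (by simp) hz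
  let t : LTree S := ⟨filledLab γ, (gammaN 0 γ).root_isSome, fun w i => by
    rw [← hγ.gammaN_lab hs (n := w.length + 1) (by simp),
      ← hγ.gammaN_lab hs (n := w.length + 1) (by simp)]
    exact (gammaN (w.length + 1) γ).child_iff w i⟩
  have ht : Tendsto (fun n => collapse (gammaN n γ)) atTop (𝓝 t) := by
    rw [tendsto_iff_dist_tendsto_zero]
    have hlim : Tendsto (fun n : ℕ => (1 / 2 : ℝ) ^ n) atTop (𝓝 0) :=
      tendsto_pow_atTop_nhds_zero_of_lt_one (by norm_num) (by norm_num)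
    refine squeeze_zero (fun _ => dist_nonneg) (fun n => ?_) hlim
    simp only [collapse, hall n, if_true]
    exact treeDist_le_of_agree (t := t) (iff_of_true (hall n) fun w => hb w) n
      fun w hw => hγ.gammaN_lab hs hw.le
  rw [tendsto_nhds_unique (tendsto_gammaN s hs γ hγ) ht]

theorem IsChoiceFunction.gammaInf_eq_botTree (hs : s ∈ treesOver (symLabels S))
    (hγ : IsChoiceFunction s γ) {w : List ℕ} (hb : filledLab γ w = some Label.bot) :
    gammaInf γ = botTree := by
  refine tendsto_nhds_unique (tendsto_gammaN s hs γ hγ) (tendsto_const_nhds.congr' ?_)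
  filter_upwards [eventually_ge_atTop w.length] with n hn
  have : ¬ NoBot (gammaN n γ) := fun h => h w (by rw [hγ.gammaN_lab hs hn, hb])
  simp [collapse, this]

end ChoiceFunction
end IOSubst

namespace IOSubst
variable {S : Signature.{u}} {Q : Type v}

namespace ParityNTA

variable (B : ParityNTA (Label.rank (S := S)) (funLabels S) Q)

/-! ### Minimal colors on paths -/

theorem exists_prefix_minColor_eq (ρ : List ℕ → Q) (w : List ℕ) :
    ∃ y, y <+: w ∧ B.minColor ρ w = B.color (ρ y) :=
  Nat.sInf_mem (s := {c | ∃ y, y <+: w ∧ c = B.color (ρ y)}) ⟨_, w, List.prefix_rfl, rfl⟩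

theorem minColor_eq_sInf_image_Icc (ρ : List ℕ → Q) (w : List ℕ) (a : ℕ → ℕ) (n : ℕ)
    (h : ∀ k ≤ w.length, a (n + k) = B.color (ρ (w.take k))) :
    sInf (a '' Set.Icc n (n + w.length)) = B.minColor ρ w := by
  unfold minColor
  congr 1
  ext c
  constructor
  · rintro ⟨k, ⟨h1, h2⟩, rfl⟩
    obtain ⟨k, rfl⟩ := Nat.exists_eq_add_of_le h1
    exact ⟨w.take k, List.take_prefix _ _, h k (by omega)⟩
  · rintro ⟨y, hy, rfl⟩
    have := hy.length_le
    refine ⟨n + y.length, ⟨by omega, by omega⟩, ?_⟩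
    rw [h _ this, ← List.prefix_iff_eq_take.1 hy]

variable {B}

/-- A run of `t` is matched by a run of an equivalent tree `t'`: for every hole of `t'` there is a
hole of `t` with the same number and the same state that is reached with a color that is at most
as good. -/
theorem TaskEquiv.exists_run {t t' : LTree S} (h : B.TaskEquiv t' t) {q : Q} {r : List ℕ → Q}
    (hr : r ∈ B.withHoles.Run t q) :
    ∃ σ ∈ B.withHoles.Run t' q, ∀ i w, t'.lab w = some (Label.hole i) →
      ∃ v, t.lab v = some (Label.hole i) ∧ r v = σ w ∧
        BestLE (B.minColor σ w) (B.minColor r v) := by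
  classical
  let A : Fin S.numHoles → Q → Set ℕ := fun i p =>
    {c | ∃ v, t.lab v = some (Label.hole i) ∧ r v = p ∧ c = B.minColor r v}
  -- The bound is the worst color that occurs. If none occurs it is `0`, which forbids the hole `i`
  -- in state `p`: colors are at least `1`, and only `0` is ⪯ `0`.
  have hA : ∀ i p, ∃ m, m ∈ insert 0 (Set.range B.color) ∧ ((A i p).Nonempty →
      m ∈ A i p ∧ ∀ a ∈ A i p, BestLE a m) ∧ (¬ (A i p).Nonempty → m = 0) := by
    intro i p
    by_cases hne : (A i p).Nonempty
    · obtain ⟨m, hm, hmax⟩ := exists_bestLE_max hne (N := B.numColors) (by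
        rintro a ⟨v, -, -, rfl⟩
        obtain ⟨y, -, hy⟩ := B.exists_prefix_minColor_eq r v
        rw [hy]
        exact (B.color_mem _).2)
      refine ⟨m, ?_, fun _ => ⟨hm, hmax⟩, fun h => absurd hne h⟩
      obtain ⟨v, -, -, rfl⟩ := hm
      obtain ⟨y, -, hy⟩ := B.exists_prefix_minColor_eq r v
      exact Or.inr ⟨_, hy.symm⟩
    · exact ⟨0, Or.inl rfl, fun h => absurd h hne, fun _ => rfl⟩
  choose ψ hψ hψ1 hψ0 using hA
  let τ : B.Task := ⟨q, ψ, hψ⟩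
  have hτ : τ ∈ B.profile t := ⟨r, hr, fun i w hw =>
    (hψ1 i (r w) ⟨_, w, hw, rfl, rfl⟩).2 _ ⟨w, hw, rfl, rfl⟩⟩
  rw [← show B.profile t' = B.profile t from h] at hτ
  obtain ⟨σ, hσ, hsat⟩ := hτ
  refine ⟨σ, hσ, fun i w hw => ?_⟩
  have hle : BestLE (B.minColor σ w) (ψ i (σ w)) := hsat i w hw
  by_cases hne : (A i (σ w)).Nonempty
  · obtain ⟨v, hv, hv', hc⟩ := (hψ1 i (σ w) hne).1
    exact ⟨v, hv, hv', hc ▸ hle⟩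
  · rw [hψ0 i _ hne] at hle
    obtain ⟨y, -, hy⟩ := B.exists_prefix_minColor_eq σ w
    have := (B.color_mem (σ y)).1
    rw [← hy] at this
    rcases hle with ⟨-, -, h⟩ | ⟨-, h⟩ | ⟨-, h, -⟩
    · omega
    · exact absurd h (by decide)
    · exact absurd h (by decide)

end ParityNTA

/-! ### Runs on the copies -/

theorem filledLab_append {γ : List ℕ → LTree S} {x y : List ℕ} (hx : (locate γ x).2 = [])
    {a : Label S} (ha : ∀ k, a ≠ Label.hole k) (h : (γ (locate γ x).1).lab y = some a) :
    filledLab γ (x ++ y) = some a := by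
  unfold filledLab
  have e : locate γ x = ((locate γ x).1, []) := by rw [← hx]
  rw [locate_append, e, foldl_stepDown_of_ne_hole]
  · exact h
  · intro z hz _ i hi
    rw [List.nil_append] at hi
    by_cases hzy : z = y
    · subst hzy
      rw [h] at hi
      exact ha i (by simpa using hi)
    · exact (γ (locate γ x).1).lab_ne_hole_of_prefix hz hzy (by simp [h]) i hi

theorem IsInfinitePath.lab_ne_of_rank_eq_zero {L : Type*} {rk : L → ℕ} {t : RTree rk}
    {α : ℕ → List ℕ} (hα : IsInfinitePath t α) (k : ℕ) {a : L} (ha : rk a = 0) :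
    t.lab (α k) ≠ some a := by
  intro h
  obtain ⟨i, hi⟩ := (hα k).2
  have h1 := (hα (k + 1)).1
  rw [hi] at h1
  obtain ⟨b, hb, hlt⟩ := (t.child_iff _ _).1 h1
  rw [h] at hb
  cases hb
  omega

/-- Away from holes a copy has the labels of `G`, and holes impose no condition. An infinite path in
the copy meets no hole, so prefixing `x` gives a path of `G`. -/
theorem ParityNTA.Run.restrict {B : ParityNTA (Label.rank (S := S)) (funLabels S) Q}
    {γ : List ℕ → LTree S} {G : LTree S} (hG : ∀ w, G.lab w = filledLab γ w) {p : Q}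
    {ρ : List ℕ → Q} (hρ : ρ ∈ B.Run G p) {x : List ℕ} (hx : (locate γ x).2 = []) :
    (fun y => ρ (x ++ y)) ∈ B.withHoles.Run (γ (locate γ x).1) (ρ x) := by
  refine ⟨fun y f hf => ?_, by simp, fun α hα => ?_⟩
  · by_cases hh : ∃ k, f = Label.hole k
    · obtain ⟨k, rfl⟩ := hh
      exact Or.inr ⟨k, rfl⟩
    · push Not at hh
      left
      have := hρ.1 (x ++ y) f (by rw [hG]; exact filledLab_append hx hh hf)
      simpa only [List.append_assoc] using this
  · refine hρ.2.2 (fun k => x ++ α k) fun k => ⟨?_, ?_⟩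
    · obtain ⟨a, ha⟩ := Option.isSome_iff_exists.1 (hα k).1
      have hh : ∀ i, a ≠ Label.hole i := by
        rintro i rfl
        exact hα.lab_ne_of_rank_eq_zero k (a := Label.hole i) rfl ha
      show (G.lab _).isSome
      rw [hG, filledLab_append hx hh ha]
      rfl
    · obtain ⟨i, hi⟩ := (hα k).2
      exact ⟨i, by simp [hi]⟩

/-- A sequence of words, each of which properly extends the previous one, determines a branch. -/
theorem exists_branch {X Y : ℕ → List ℕ} (hX : ∀ i, X (i + 1) = X i ++ Y i)
    (hY : ∀ i, Y i ≠ []) :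
    ∃ β : ℕ → List ℕ, (∀ k, β k <+: X k) ∧ (∀ k, ∃ j, β (k + 1) = β k ++ [j]) ∧
      ∀ i k, k ≤ (Y i).length → β ((X i).length + k) = X i ++ (Y i).take k := by
  have hlen : ∀ k, k ≤ (X k).length := by
    intro k
    induction k with
    | zero => simp
    | succ k ih =>
      have := List.length_pos_iff.2 (hY k)
      rw [hX, List.length_append]
      omega
  have hmono : ∀ i j, i ≤ j → X i <+: X j := by
    intro i j hij
    induction j, hij using Nat.le_induction with
    | base => exact List.prefix_rfl
    | succ j _ ih => exact ih.trans (hX j ▸ List.prefix_append _ _)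
  have htake : ∀ i j k, i ≤ j → k ≤ (X i).length → (X j).take k = (X i).take k := by
    intro i j k hij hk
    obtain ⟨z, hz⟩ := hmono i j hij
    rw [← hz, List.take_append_of_le_length hk]
  -- `X k` has at least `k` letters, so this prefix has length exactly `k`.
  refine ⟨fun k => (X k).take k, fun k => List.take_prefix _ _, fun k => ?_, fun i k hk => ?_⟩
  · have := hlen (k + 1)
    refine ⟨(X (k + 1))[k], ?_⟩
    simp only
    rw [← htake k (k + 1) k (by omega) (hlen k), List.take_append_getElem]
  · have h1 : (X i ++ Y i).take ((X i).length + k) = X i ++ (Y i).take k := by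
      rw [List.take_length_add_append]
    have h2 : (X i).length + k ≤ (X (i + 1)).length := by
      rw [hX, List.length_append]
      omega
    simp only
    rw [← h1, ← hX]
    rcases le_total (i + 1) ((X i).length + k) with h | h
    · rw [htake _ _ _ h h2]
    · rw [htake _ _ _ h (hlen _)]

/-! ### Transferring a run from `γ_∞(s)` to `γ'_∞(s)` -/

/-- The pair `(x, v)` for a position `w` of `γ'_∞(s)`: the position `v` of a copy of a tree `γ'(u)`
that is related to the copy of `γ(u)` with the root `x` in `γ_∞(s)`. -/
def track (γ γ' : List ℕ → LTree S) (leaf : List ℕ → List ℕ → List ℕ) (w : List ℕ) :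
    List ℕ × List ℕ :=
  w.foldl (stepDown (fun x => γ' (locate γ x).1) (fun x v _ => x ++ leaf x v)) ([], [])

/-- Runs `σ x` on copies of the trees `γ' u` that are matched with the restrictions of the run `ρ`
to the copies of the trees `γ u`. -/
structure IsMatching (B : ParityNTA (Label.rank (S := S)) (funLabels S) Q)
    (γ γ' : List ℕ → LTree S) (ρ : List ℕ → Q) (σ : List ℕ → List ℕ → Q)
    (leaf : List ℕ → List ℕ → List ℕ) : Prop where
  run : ∀ x, (locate γ x).2 = [] → σ x ∈ B.withHoles.Run (γ' (locate γ x).1) (ρ x)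
  hole : ∀ x, (locate γ x).2 = [] → ∀ i v, (γ' (locate γ x).1).lab v = some (Label.hole i) →
    (γ (locate γ x).1).lab (leaf x v) = some (Label.hole i) ∧ ρ (x ++ leaf x v) = σ x v ∧
      BestLE (B.minColor (σ x) v) (B.minColor (fun y => ρ (x ++ y)) (leaf x v))

theorem track_append_singleton (γ γ' : List ℕ → LTree S) (leaf : List ℕ → List ℕ → List ℕ)
    (w : List ℕ) (j : ℕ) : track γ γ' leaf (w ++ [j]) =
      stepDown (fun x => γ' (locate γ x).1) (fun x v _ => x ++ leaf x v) (track γ γ' leaf w) j := by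
  simp [track, List.foldl_append]

namespace IsMatching

variable {B : ParityNTA (Label.rank (S := S)) (funLabels S) Q} {s : LTree S}
  {γ γ' : List ℕ → LTree S} {ρ : List ℕ → Q} {σ : List ℕ → List ℕ → Q}
  {leaf : List ℕ → List ℕ → List ℕ}

theorem leaf_ne_nil (M : IsMatching B γ γ' ρ σ leaf) (hs : s ∈ treesOver (symLabels S))
    (hγ : IsChoiceFunction s γ) {x : List ℕ} (hx : (locate γ x).2 = []) {v : List ℕ}
    {i : Fin S.numHoles} (hv : (γ' (locate γ x).1).lab v = some (Label.hole i)) :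
    leaf x v ≠ [] := by
  intro h
  have := (M.hole x hx i v hv).1
  rw [h] at this
  exact hγ.root_ne_hole hs (hγ.locate_fst_mem hs x) i this

theorem locate_append_leaf (M : IsMatching B γ γ' ρ σ leaf) (hs : s ∈ treesOver (symLabels S))
    (hγ : IsChoiceFunction s γ) {x : List ℕ} (hx : (locate γ x).2 = []) {v : List ℕ}
    {i : Fin S.numHoles} (hv : (γ' (locate γ x).1).lab v = some (Label.hole i)) :
    locate γ (x ++ leaf x v) = ((locate γ x).1 ++ [(i : ℕ)], []) := by
  have e : locate γ x = ((locate γ x).1, []) := by rw [← hx]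
  rw [locate_append, e, foldl_stepDown_of_hole _ _ _ (M.leaf_ne_nil hs hγ hx hv) i]
  exact (M.hole x hx i v hv).1

/-- Partner leaves carry the same hole number, so both walks descend to the same child in `s`. -/
theorem track_spec (M : IsMatching B γ γ' ρ σ leaf) (hs : s ∈ treesOver (symLabels S))
    (hγ : IsChoiceFunction s γ) (w : List ℕ) :
    (locate γ (track γ γ' leaf w).1).2 = [] ∧
      locate γ' w = ((locate γ (track γ γ' leaf w).1).1, (track γ γ' leaf w).2) := by
  induction w using List.reverseRecOn with
  | nil => exact ⟨rfl, rfl⟩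
  | append_singleton w j ih =>
    obtain ⟨h1, h2⟩ := ih
    rw [track_append_singleton, locate_append_singleton, h2]
    generalize track γ γ' leaf w = p at *
    by_cases h : ∃ i, (γ' (locate γ p.1).1).lab (p.2 ++ [j]) = some (Label.hole i)
    · obtain ⟨i, hi⟩ := h
      rw [stepDown_of_hole (T := fun x => γ' (locate γ x).1) hi, stepDown_of_hole hi]
      simp only
      rw [M.locate_append_leaf hs hγ h1 hi]
      simp
    · push Not at h
      rw [stepDown_of_ne_hole (T := fun x => γ' (locate γ x).1) h, stepDown_of_ne_hole h]
      exact ⟨h1, rfl⟩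

theorem filledLab_eq (M : IsMatching B γ γ' ρ σ leaf) (hs : s ∈ treesOver (symLabels S))
    (hγ : IsChoiceFunction s γ) (w : List ℕ) :
    filledLab γ' w = (γ' (locate γ (track γ γ' leaf w).1).1).lab (track γ γ' leaf w).2 := by
  unfold filledLab
  rw [(M.track_spec hs hγ w).2]

theorem run_append_leaf (M : IsMatching B γ γ' ρ σ leaf) (hs : s ∈ treesOver (symLabels S))
    (hγ : IsChoiceFunction s γ) {x : List ℕ} (hx : (locate γ x).2 = []) {v : List ℕ}
    {i : Fin S.numHoles} (hv : (γ' (locate γ x).1).lab v = some (Label.hole i)) :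
    σ (x ++ leaf x v) [] = σ x v := by
  rw [(M.run (x ++ leaf x v) (by rw [M.locate_append_leaf hs hγ hx hv])).2.1,
    (M.hole x hx i v hv).2.1]

/-- The gluing condition: at a hole, the state of the old run is the initial state of the new one.
-/
theorem run_track_append_singleton (M : IsMatching B γ γ' ρ σ leaf)
    (hs : s ∈ treesOver (symLabels S)) (hγ : IsChoiceFunction s γ) (w : List ℕ) (j : ℕ) :
    σ (track γ γ' leaf (w ++ [j])).1 (track γ γ' leaf (w ++ [j])).2 =
      σ (track γ γ' leaf w).1 ((track γ γ' leaf w).2 ++ [j]) := by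
  have h1 := (M.track_spec hs hγ w).1
  rw [track_append_singleton]
  generalize track γ γ' leaf w = p at *
  by_cases h : ∃ i, (γ' (locate γ p.1).1).lab (p.2 ++ [j]) = some (Label.hole i)
  · obtain ⟨i, hi⟩ := h
    rw [stepDown_of_hole (T := fun x => γ' (locate γ x).1) hi]
    exact M.run_append_leaf hs hγ h1 hi
  · push Not at h
    rw [stepDown_of_ne_hole (T := fun x => γ' (locate γ x).1) h]

theorem trans_of_filledLab (M : IsMatching B γ γ' ρ σ leaf) (hs : s ∈ treesOver (symLabels S))
    (hγ : IsChoiceFunction s γ) (hγ' : IsChoiceFunction s γ') {w : List ℕ} {f : Label S}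
    (hf : filledLab γ' w = some f) :
    B.trans (σ (track γ γ' leaf w).1 (track γ γ' leaf w).2) f
      (fun j => σ (track γ γ' leaf (w ++ [(j : ℕ)])).1 (track γ γ' leaf (w ++ [(j : ℕ)])).2) := by
  simp only [M.run_track_append_singleton hs hγ]
  have hf' := hf
  rw [M.filledLab_eq hs hγ] at hf'
  rcases (M.run _ (M.track_spec hs hγ w).1).1 _ _ hf' with h | ⟨i, rfl⟩
  · exact h
  · exact absurd hf (hγ'.filledLab_ne_hole hs w i)

/-! ### The parity condition for the glued run -/

/-- From time `n` on the path stays in one copy, where its tail is an infinite path on which the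
corresponding `σ x` is accepting. -/
theorem even_liminf_of_eventually_ne_nil (M : IsMatching B γ γ' ρ σ leaf)
    (hs : s ∈ treesOver (symLabels S)) (hγ : IsChoiceFunction s γ) {G' : LTree S}
    (hG' : ∀ w, G'.lab w = filledLab γ' w) {α : ℕ → List ℕ} (hα : IsInfinitePath G' α) {n : ℕ}
    (hn : ∀ m > n, (track γ γ' leaf (α m)).2 ≠ []) :
    Even (liminf (fun k => B.color (σ (track γ γ' leaf (α k)).1 (track γ γ' leaf (α k)).2))
      atTop) := by
  have hstep : ∀ m, n ≤ m → (track γ γ' leaf (α (m + 1))).1 = (track γ γ' leaf (α m)).1 ∧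
      ∃ j, (track γ γ' leaf (α (m + 1))).2 = (track γ γ' leaf (α m)).2 ++ [j] := by
    intro m hm
    obtain ⟨j, hj⟩ := (hα m).2
    have hne := hn (m + 1) (by omega)
    rw [hj, track_append_singleton] at hne ⊢
    generalize track γ γ' leaf (α m) = p at *
    rw [stepDown_of_ne_hole]
    · exact ⟨rfl, j, rfl⟩
    · intro i hi
      rw [stepDown_of_hole hi] at hne
      exact hne rfl
  have hfst : ∀ m, (track γ γ' leaf (α (m + n))).1 = (track γ γ' leaf (α n)).1 := by
    intro m
    induction m with
    | zero => simp
    | succ m ih => rw [← ih, ← (hstep (m + n) (by omega)).1, Nat.succ_add_eq_add_succ]; rfl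
  rw [← liminf_nat_add _ n]
  simp only [hfst]
  refine (M.run _ (M.track_spec hs hγ (α n)).1).2.2 (fun k => (track γ γ' leaf (α (k + n))).2)
    fun k => ⟨?_, ?_⟩
  · have := (hα (k + n)).1
    change (G'.lab _).isSome at this
    rw [hG', M.filledLab_eq hs hγ, hfst] at this
    exact this
  · obtain ⟨j, hj⟩ := (hstep (k + n) (by omega)).2
    refine ⟨j, ?_⟩
    simp only
    rw [← hj, Nat.add_right_comm]

/-- The path crosses infinitely many copies; their partner crossings form a branch of `G`, and
acceptance of `ρ` there is transferred block by block. -/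
theorem even_liminf_of_frequently_nil (M : IsMatching B γ γ' ρ σ leaf)
    (hs : s ∈ treesOver (symLabels S)) (hγ : IsChoiceFunction s γ) {G G' : LTree S}
    (hG : ∀ w, G.lab w = filledLab γ w) {p : Q} (hρ : ρ ∈ B.Run G p)
    {α : ℕ → List ℕ} (hα : IsInfinitePath G' α)
    (hinf : ∀ n, ∃ m > n, (track γ γ' leaf (α m)).2 = []) :
    Even (liminf (fun k => B.color (σ (track γ γ' leaf (α k)).1 (track γ γ' leaf (α k)).2))
      atTop) := by
  set q : ℕ → List ℕ × List ℕ := fun k => track γ γ' leaf (α k) with hq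
  have hspec : ∀ k, (locate γ (q k).1).2 = [] := fun k => (M.track_spec hs hγ (α k)).1
  have hstep : ∀ m, ∃ j, q (m + 1) =
      stepDown (fun x => γ' (locate γ x).1) (fun x v _ => x ++ leaf x v) (q m) j := by
    intro m
    obtain ⟨j, hj⟩ := (hα m).2
    exact ⟨j, by simp only [hq]; rw [hj, track_append_singleton]⟩
  have hcross : ∀ n, ∃ V, (q n).2 = [] → V ≠ [] ∧
      (∃ i, (γ' (locate γ (q n).1).1).lab V = some (Label.hole i)) ∧
      q (n + V.length) = ((q n).1 ++ leaf (q n).1 V, []) ∧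
      ∀ k < V.length, q (n + k) = ((q n).1, V.take k) := by
    intro n
    by_cases hn : (q n).2 = []
    · obtain ⟨V, i, h1, h2, h3, h4⟩ := exists_crossing hstep hn (hinf n)
      exact ⟨V, fun _ => ⟨h1, ⟨i, h2⟩, h3, h4⟩⟩
    · exact ⟨[], fun h => absurd h hn⟩
  choose V hV using hcross
  obtain ⟨n₀, -, hn₀⟩ := hinf 0
  -- `N i` is a time of entry into a copy, and `V (N i)` is the word read until the next entry.
  let N : ℕ → ℕ := fun i => Nat.rec n₀ (fun _ n => n + (V n).length) i
  have hNs : ∀ i, N (i + 1) = N i + (V (N i)).length := fun i => rfl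
  have hN : ∀ i, (q (N i)).2 = [] := by
    intro i
    induction i with
    | zero => exact hn₀
    | succ i ih => rw [hNs, (hV _ ih).2.2.1]
  have hNmono : StrictMono N := strictMono_nat_of_lt_succ fun i => by
    have := List.length_pos_iff.2 (hV _ (hN i)).1
    rw [hNs]
    omega
  let X : ℕ → List ℕ := fun i => (q (N i)).1
  let W : ℕ → List ℕ := fun i => V (N i)
  let Y : ℕ → List ℕ := fun i => leaf (X i) (W i)
  have hXs : ∀ i, X (i + 1) = X i ++ Y i := fun i => by
    change (q (N (i + 1))).1 = _
    rw [hNs, (hV _ (hN i)).2.2.1]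
  have hY : ∀ i, Y i ≠ [] := fun i => by
    obtain ⟨l, hl⟩ := (hV _ (hN i)).2.1
    exact M.leaf_ne_nil hs hγ (hspec _) hl
  obtain ⟨β, hβ1, hβ2, hβ3⟩ := exists_branch hXs hY
  have hβ : IsInfinitePath G β := by
    refine fun k => ⟨?_, hβ2 k⟩
    obtain ⟨z, hz⟩ := hβ1 k
    apply G.isSome_of_append (β k) z
    rw [hz, hG]
    unfold filledLab
    rw [show (locate γ (X k)).2 = [] from hspec _]
    exact (γ _).root_isSome
  have hle := hρ.2.2 β hβ
  have hbd : ∀ r : ℕ → Q, ∀ k, B.color (r k) ≤ B.numColors := fun r k => (B.color_mem _).2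
  have hXmono : StrictMono fun i => (X i).length := strictMono_nat_of_lt_succ fun i => by
    have := List.length_pos_iff.2 (hY i)
    rw [hXs, List.length_append]
    omega
  -- Matching blocks of the two paths may differ in length, so only their minima are compared.
  rw [← liminf_sInf_image_Icc (hbd _) hXmono] at hle
  rw [← liminf_sInf_image_Icc (hbd _) hNmono]
  have e1 : ∀ i, sInf ((fun k => B.color (ρ (β k))) '' Set.Icc (X i).length (X (i + 1)).length) =
      B.minColor (fun y => ρ (X i ++ y)) (Y i) := by
    intro i
    rw [hXs, List.length_append]
    refine B.minColor_eq_sInf_image_Icc _ _ _ _ fun k hk => ?_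
    rw [hβ3 i k hk]
  have e2 : ∀ i, sInf ((fun k => B.color (σ (q k).1 (q k).2)) '' Set.Icc (N i) (N (i + 1))) =
      B.minColor (σ (X i)) (W i) := by
    intro i
    rw [hNs]
    refine B.minColor_eq_sInf_image_Icc _ _ _ _ fun k hk => ?_
    obtain ⟨-, ⟨l, hl⟩, h3, h4⟩ := hV _ (hN i)
    rcases hk.lt_or_eq with hk | rfl
    · rw [h4 k hk]
    -- The right end of the block already lies in the next copy; by the gluing condition its state
    -- is also that of the hole just left.
    · rw [h3, List.take_length]
      exact congrArg B.color (M.run_append_leaf hs hγ (hspec _) hl)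
  have hmin : ∀ r w, B.minColor r w ≤ B.numColors := fun r w => by
    obtain ⟨y, -, hy⟩ := B.exists_prefix_minColor_eq r w
    rw [hy]
    exact (B.color_mem _).2
  simp only [e1] at hle
  change Even (liminf (fun i => sInf ((fun k => B.color (σ (q k).1 (q k).2)) ''
    Set.Icc (N i) (N (i + 1)))) atTop)
  simp only [e2]
  refine even_liminf_of_bestLE (fun i => hmin _ _) (fun i => hmin _ _) (fun i => ?_) hle
  obtain ⟨l, hl⟩ := (hV _ (hN i)).2.1
  exact (M.hole (X i) (hspec _) l (W i) hl).2.2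

end IsMatching

theorem exists_isMatching {B : ParityNTA (Label.rank (S := S)) (funLabels S) Q} {s : LTree S}
    (hs : s ∈ treesOver (symLabels S)) {γ γ' : List ℕ → LTree S} (hγ : IsChoiceFunction s γ)
    (h : ∀ w ∈ s.Pos, B.TaskEquiv (γ' w) (γ w)) {G : LTree S}
    (hG : ∀ w, G.lab w = filledLab γ w) {p : Q} {ρ : List ℕ → Q} (hρ : ρ ∈ B.Run G p) :
    ∃ σ leaf, IsMatching B γ γ' ρ σ leaf := by
  have key : ∀ x, ∃ (σ : List ℕ → Q) (leaf : List ℕ → List ℕ), (locate γ x).2 = [] →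
      σ ∈ B.withHoles.Run (γ' (locate γ x).1) (ρ x) ∧
      ∀ i v, (γ' (locate γ x).1).lab v = some (Label.hole i) →
        (γ (locate γ x).1).lab (leaf v) = some (Label.hole i) ∧ ρ (x ++ leaf v) = σ v ∧
        BestLE (B.minColor σ v) (B.minColor (fun y => ρ (x ++ y)) (leaf v)) := by
    intro x
    by_cases hx : (locate γ x).2 = []
    · obtain ⟨σ, hσ, hh⟩ := (h _ (hγ.locate_fst_mem hs x)).exists_run
        (ParityNTA.Run.restrict hG hρ hx)
      -- The partner can be chosen independently of `i`, since the label at `v` determines the hole.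
      have hh' : ∀ v, ∃ y, ∀ i, (γ' (locate γ x).1).lab v = some (Label.hole i) →
          (γ (locate γ x).1).lab y = some (Label.hole i) ∧ ρ (x ++ y) = σ v ∧
          BestLE (B.minColor σ v) (B.minColor (fun y => ρ (x ++ y)) y) := by
        intro v
        by_cases hv : ∃ i, (γ' (locate γ x).1).lab v = some (Label.hole i)
        · obtain ⟨i, hi⟩ := hv
          obtain ⟨y, hy⟩ := hh i v hi
          refine ⟨y, fun i' hi' => ?_⟩
          rw [hi] at hi'
          cases hi'
          exact hy
        · exact ⟨[], fun i hi => absurd ⟨i, hi⟩ hv⟩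
      choose leaf hleaf using hh'
      exact ⟨σ, leaf, fun _ => ⟨hσ, fun i v => hleaf v i⟩⟩
    · exact ⟨ρ, id, fun h => absurd h hx⟩
  choose σ leaf hkey using key
  exact ⟨σ, leaf, fun x hx => (hkey x hx).1, fun x hx => (hkey x hx).2⟩

theorem gammaInf_mem_language_of_taskEquiv
    {B : ParityNTA (Label.rank (S := S)) (funLabels S) Q} {s : LTree S}
    (hs : s ∈ treesOver (symLabels S)) {γ γ' : List ℕ → LTree S} (hγ : IsChoiceFunction s γ)
    (hγ' : IsChoiceFunction s γ') (h : ∀ w ∈ s.Pos, B.TaskEquiv (γ' w) (γ w)) {p : Q}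
    (hp : gammaInf γ ∈ B.language p) : gammaInf γ' ∈ B.language p := by
  obtain ⟨hlab, ρ, hρ⟩ := hp
  have hbot : ∀ w, filledLab γ w ≠ some Label.bot := by
    intro w hw
    rw [hγ.gammaInf_eq_botTree hs hw] at hlab
    obtain ⟨x, -, hx⟩ := hlab [] Label.bot (by simp [botTree, leafTree])
    simp at hx
  have hG := hγ.gammaInf_lab hs hbot
  obtain ⟨σ, leaf, M⟩ := exists_isMatching hs hγ h hG hρ
  -- This holds for `filledLab γ'` whether or not ⊥ occurs, so it can be used to exclude ⊥ before
  -- `gammaInf γ'` is identified.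
  have htrans := fun w f => M.trans_of_filledLab (w := w) (f := f) hs hγ hγ'
  have hG' : ∀ w, (gammaInf γ').lab w = filledLab γ' w := by
    refine hγ'.gammaInf_lab hs fun w hw => ?_
    obtain ⟨x, -, hx⟩ := B.trans_mem _ _ _ (htrans w _ hw)
    simp at hx
  refine ⟨fun w a ha => B.trans_mem _ _ _ (htrans w a (hG' w ▸ ha)),
    fun w => σ (track γ γ' leaf w).1 (track γ γ' leaf w).2,
    fun w f hf => htrans w f (hG' w ▸ hf), ?_, fun α hα => ?_⟩
  · exact ((M.run [] rfl).2.1).trans hρ.2.1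
  · by_cases hinf : ∀ n, ∃ m > n, (track γ γ' leaf (α m)).2 = []
    · exact M.even_liminf_of_frequently_nil hs hγ hG hρ hα hinf
    · push Not at hinf
      obtain ⟨n, hn⟩ := hinf
      exact M.even_liminf_of_eventually_ne_nil hs hγ hG' hα hn

end IOSubst

theorem mainTheorem5 (S : Signature) {Q : Type*} [Finite Q] [Nonempty Q]
    (B : ParityNTA (Label.rank (S := S)) (funLabels S) Q)
    (s : LTree S) (hs : s ∈ treesOver (symLabels S))
    (γ γ' : List ℕ → LTree S) (hγ : IsChoiceFunction s γ) (hγ' : IsChoiceFunction s γ')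
    (h : ∀ w ∈ s.Pos, B.TaskEquiv (γ' w) (γ w)) (p₀ : Q) :
    gammaInf γ ∈ B.language p₀ ↔ gammaInf γ' ∈ B.language p₀ :=
  ⟨gammaInf_mem_language_of_taskEquiv hs hγ hγ' h,
    gammaInf_mem_language_of_taskEquiv hs hγ' hγ fun w hw => (h w hw).symm⟩
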